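/- Conventions. All Banach spaces are real. Cardinals are identified with initial ordinals. $\mathbb N^*=\beta\mathbb N\setminus\mathbb N$ is the space of non-principal ultrafilters on $\mathbb N$; for $A\subseteq\mathbb N$, $[A]\subseteq\mathbb N^*$ is the clopen set of those ultrafilters that contain $A$, and $1_{[A]}\in C(\mathbb N^*)$ is its characteristic function. $\ell_\infty^c(\kappa)$ is the subspace of $\ell_\infty(\kappa)$ (supremum norm) consisting of the countably supported elements. $A\subseteq^*B$ means that $A\setminus B$ is finite, and $A=^*B$ means $A\subseteq^*B\subseteq^*A$; for functions on a common domain, $=^*$ means that they differ at only finitely many points. An almost disjoint family $\{A_\xi:\xi<\kappa\}$ ($\kappa$ infinite) consists of infinite subsets of $\mathbb N$ with $A_\xi\cap A_\eta$ finite whenever $\xi\neq\eta$. Two families $\mathcal B,\mathcal C$ of subsets of $\mathbb N$ are separated if there is $D\subseteq\mathbb N$ with $B\subseteq^*D$ for all $B\in\mathcal B$ and $C\cap D$ finite for all $C\in\mathcal C$. An isometric embedding is a linear isometry, not necessarily onto. The bounding number $\mathfrak b$ is the least cardinality of a subset of $\mathbb N^{\mathbb N}$ that is unbounded with respect to eventual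 pointwise domination. A coherent family is a family $\{s_\alpha:\alpha<\omega_1\}$ of injections $s_\alpha:\omega\cdot\alpha\to\omega$ with $s_\alpha|_{\omega\cdot\beta}=^*s_\beta$ for all $\beta<\alpha<\omega_1$. Put $I_\xi=[\omega\cdot\xi,\omega\cdot\xi+\omega)$ for $\xi<\omega_1$. Theorem (ZFC). (a) $\mathfrak b=\omega_1$ if and only if there is an almost disjoint family $\{A_\xi:\xi<\omega_1\}$ such that there is no isometric embedding $S:\ell_\infty^c(\omega_1)\to C(\mathbb N^*)$ satisfying $S(1_{\{\xi\}})=1_{[A_\xi]}$ for every $\xi<\omega_1$. (b) There is an almost disjoint family $\{A_\xi:\xi<\mathfrak b\}$ which is the union of two disjoint subfamilies $\mathcal B$ and $\mathcal C$ with $|\mathcal B|=\mathfrak b$ and $|\mathcal C|=\omega$ that are not separated, and such that there is no isometric embedding $S:\ell_\infty^c(\mathfrak b)\to C(\mathbb N^*)$ satisfying $S(1_{\{\xi\}})=1_{[A_\xi]}$ for every $\xi<\mathfrak b$. (c) If $\mathfrak b>\omega_1$, then for every almost disjoint family $\{A_\xi:\xi<\omega_1\}$ there are a coherent family $\{s_\alpha:\alpha<\omega_1\}$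 such that $A_\xi=^*s_{\xi+1}[I_\xi]$ for every $\xi<\omega_1$, and an isometric embedding $S:\ell_\infty^c(\omega_1)\to C(\mathbb N^*)$ such that $S(1_{\{\xi\}})=1_{[A_\xi]}$ for every $\xi<\omega_1$ and, more generally, $S(1_X)=1_{[s_\alpha[\bigcup_{\xi\in X}I_\xi]]}$ for every countable $X\subseteq\omega_1$ and every $\alpha<\omega_1$ with $X\subseteq\alpha$. -/

import Mathlib

open Set Filter Topology
open scoped Cardinal Ordinal ENNReal

noncomputable section

/-- The bounding number `𝔟`: the least cardinality of a family of functions `ℕ → ℕ` which is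
unbounded in the order of eventual pointwise domination. -/
def boundingNumber : Cardinal.{0} :=
  sInf {c | ∃ F : Set (ℕ → ℕ), #F = c ∧ ¬ ∃ g : ℕ → ℕ, ∀ f ∈ F, ∀ᶠ n in atTop, f n ≤ g n}

/-- The index set `{ξ : ξ < κ}` of a cardinal `κ` (identified with its initial ordinal). -/
abbrev Below (κ : Cardinal.{0}) : Type 1 := Set.Iio κ.ord

/-- `A ⊆* B`. -/
def AlmostSubset (A B : Set ℕ) : Prop := (A \ B).Finite

/-- `A =* B`. -/
def AlmostEq (A B : Set ℕ) : Prop := AlmostSubset A B ∧ AlmostSubset B A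

/-- `{A i : i ∈ ι}`, enumerated without repetitions, is an (infinite) almost disjoint family of
infinite subsets of `ℕ`. The enumeration is automatically injective, since the sets are infinite
and sets with distinct indices have finite intersection. -/
structure IsAlmostDisjointFamily {ι : Type*} (A : ι → Set ℕ) : Prop where
  infinite_index : Infinite ι
  infinite : ∀ i, (A i).Infinite
  almostDisjoint : ∀ i j, i ≠ j → (A i ∩ A j).Finite

/-- The family `𝒜` is separated from the family `ℬ`: some `D ⊆ ℕ` almost contains every member
of `𝒜` and is almost disjoint from every member of `ℬ`. -/
def IsSeparatedFrom (𝒜 ℬ : Set (Set ℕ)) : Prop :=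
  ∃ D : Set ℕ, (∀ A ∈ 𝒜, AlmostSubset A D) ∧ ∀ B ∈ ℬ, AlmostEq (B ∩ D) ∅

/-- `ℕ* = βℕ \ ℕ`, where `βℕ` is the space of ultrafilters on `ℕ` and `ℕ` is identified with the
principal ultrafilters. -/
abbrev NStar : Type := ↥((Set.range (pure : ℕ → Ultrafilter ℕ))ᶜ)

instance NStar.instCompactSpace : CompactSpace NStar := by
  rw [← isCompact_iff_compactSpace]
  refine IsClosed.isCompact ?_
  rw [isClosed_compl_iff]
  have h : Set.range (pure : ℕ → Ultrafilter ℕ) = ⋃ n : ℕ, {u : Ultrafilter ℕ | {n} ∈ u} := by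
    ext u
    rw [Set.mem_iUnion]
    constructor
    · rintro ⟨n, rfl⟩
      exact ⟨n, Ultrafilter.mem_pure.2 rfl⟩
    · rintro ⟨n, hn⟩
      obtain ⟨x, hx, h⟩ := Ultrafilter.eq_pure_of_finite_mem (Set.finite_singleton n) hn
      exact ⟨x, h.symm⟩
  rw [h]
  exact isOpen_iUnion fun n => ultrafilter_isOpen_basic {n}

/-- The clopen subset `[A]` of `ℕ*` which corresponds to the class of `A` in `℘(ℕ)/Fin`. -/
def starClopen (A : Set ℕ) : Set NStar := {x | A ∈ x.1}

theorem isClopen_starClopen (A : Set ℕ) : IsClopen (starClopen A) :=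
  ⟨(ultrafilter_isClosed_basic A).preimage continuous_subtype_val,
    (ultrafilter_isOpen_basic A).preimage continuous_subtype_val⟩

/-- The characteristic function `1_[A] ∈ C(ℕ*)`. -/
def starIndicator (A : Set ℕ) : C(NStar, ℝ) where
  toFun := (starClopen A).indicator 1
  continuous_toFun := (IsClopen.continuous_indicator (isClopen_starClopen A) continuous_one)

/-- `ℓ∞ᶜ(ι)`: the subspace of `ℓ∞(ι)` of all countably supported elements, with the supremum
norm inherited from `ℓ∞(ι)`. -/
def ellInftyC (ι : Type*) : Submodule ℝ (lp (fun _ : ι => ℝ) ∞) where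
  carrier := {f | (Function.support (f : ι → ℝ)).Countable}
  zero_mem' := by
    change (Function.support (0 : ι → ℝ)).Countable
    simp
  add_mem' := by
    intro f g hf hg
    refine (Set.Countable.union hf hg).mono ?_
    rw [lp.coeFn_add]
    exact Function.support_add _ _
  smul_mem' := by
    intro c f hf
    refine Set.Countable.mono ?_ hf
    rw [lp.coeFn_smul]
    exact Function.support_const_smul_subset c _

/-- The characteristic function `1_X ∈ ℓ∞ᶜ(ι)` of a countable set `X ⊆ ι`. -/
def charFn {ι : Type*} (X : Set ι) (hX : X.Countable) : ellInftyC ι :=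
  ⟨⟨X.indicator 1, memℓp_infty ⟨1, by
      rintro _ ⟨i, rfl⟩
      by_cases h : i ∈ X <;> simp [h]⟩⟩,
    hX.mono Set.support_indicator_subset⟩

/-- The linear isometry `S : ℓ∞ᶜ(ι) → C(ℕ*)` satisfies `S(1_{i}) = 1_[A i]` for every `i`. -/
def Represents {ι : Type*} (S : ellInftyC ι →ₗᵢ[ℝ] C(NStar, ℝ)) (A : ι → Set ℕ) : Prop :=
  ∀ i, S (charFn {i} (Set.countable_singleton i)) = starIndicator (A i)

/-- The interval of ordinals `[ω·ξ, ω·ξ + ω)`. -/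
def ordBlock (ξ : Ordinal.{0}) : Set Ordinal.{0} := Set.Ico (ω * ξ) (ω * ξ + ω)

/-- A coherent family `{s_α : α < ω₁}` of injections `s_α : ω·α → ω`: for `β < α` the functions
`s_α` and `s_β` differ only at finitely many points of `ω·β`. Only the values of `s α` at ordinals
below `ω·α`, for `α < ω₁`, are relevant. -/
structure IsCoherentFamily (s : Ordinal.{0} → Ordinal.{0} → ℕ) : Prop where
  injOn : ∀ α < ω_ 1, Set.InjOn (s α) (Set.Iio (ω * α))
  coherent : ∀ α < ω_ 1, ∀ β < α, {γ | γ < ω * β ∧ s α γ ≠ s β γ}.Finite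

end

/-! The link between isometric embeddings and combinatorics is separation. If `S` is an isometric
embedding with `S(1_{i}) = 1_[A i]`, then the norms of `1_X - 2·1_{i}` for `i ∈ X` and of
`1_X ± 1_{i}` for `i ∉ X` force `S(1_X)` to be `1` on `[A i]` for `i ∈ X` and `0` on `[A i]` for
`i ∉ X`. So each countable part of the family is separated from the rest
(`Represents.isSeparatedFrom`). In `ℕ × ℕ`, the columns together with the graphs of the members of
an unbounded family of `𝔟` functions, modified so as to be almost disjoint, form an almost disjoint
family in which the graphs are not separated from the columns, because a separating set would give
a bound (`not_isSeparatedFrom_branchGraph`). No such `S` exists for this family.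

Conversely, let `𝔟 > ω₁` and let `A ξ`, `ξ < ω₁`, be almost disjoint. By recursion on `α < ω₁` one
finds functions `p α` on `ℕ` with values at most `α`, such that `{p α = ξ}` is almost equal to
`A ξ` for `ξ < α`, the other sets `A β` are almost contained in `{p α = α}`, and `min (p α) β` is
almost equal to `p β` for `β < α` (`exists_coherent_labellings`). At a limit of cofinality `ω` one
has to discard finitely many values of each of countably many labellings, in a way compatible with
all of the remaining `ω₁` sets; this is a domination problem for `ω₁` functions
(`exists_isLabelling_limit`). Following enumerations of the sets `A ξ` as long as they have the right
label turns the labellings into a coherent family of injections. The exceptional places are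
absorbed by an infinite set almost disjoint from all the `A ξ`, which exists by another domination
argument (`exists_isCoherentFamily_of_labellings`, `exists_injective_almostDisjoint`).

A coherent family `s` yields an embedding: an element `f` supported below `α` is spread over `ℕ`
with the value `f ξ` on the image under `s α` of the `ξ`-th block. By coherence, the result modulo
`c₀` does not depend on `α`, and `ℓ∞/c₀` is `C(ℕ*)`
(`IsCoherentFamily.exists_linearIsometry`). -/

/-! ### Subsets of `ℕ` and clopen subsets of `ℕ*` -/

theorem starIndicator_apply_of_mem {A : Set ℕ} {u : NStar} (h : A ∈ u.1) :
    starIndicator A u = 1 :=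
  Set.indicator_of_mem (show u ∈ starClopen A from h) _

theorem starIndicator_apply_of_notMem {A : Set ℕ} {u : NStar} (h : A ∉ u.1) :
    starIndicator A u = 0 :=
  Set.indicator_of_notMem (show u ∉ starClopen A from h) _

theorem NStar.notMem_of_finite {A : Set ℕ} (hA : A.Finite) (u : NStar) : A ∉ u.1 := by
  intro h
  obtain ⟨x, -, hx⟩ := Ultrafilter.eq_pure_of_finite_mem hA h
  exact u.2 ⟨x, hx.symm⟩

theorem NStar.exists_mem_of_infinite {A : Set ℕ} (hA : A.Infinite) : ∃ u : NStar, A ∈ u.1 := by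
  have : (cofinite ⊓ 𝓟 A).NeBot := cofinite_inf_principal_neBot_iff.2 hA
  have hle := Ultrafilter.of_le (cofinite ⊓ 𝓟 A)
  refine ⟨⟨Ultrafilter.of (cofinite ⊓ 𝓟 A), ?_⟩, hle (mem_inf_of_right (mem_principal_self A))⟩
  rintro ⟨n, hn⟩
  have h1 : ({n}ᶜ : Set ℕ) ∈ Ultrafilter.of (cofinite ⊓ 𝓟 A) :=
    hle (mem_inf_of_left (by simp))
  rw [← hn, Ultrafilter.mem_pure] at h1
  exact h1 rfl

theorem NStar.mem_of_almostSubset {A B : Set ℕ} (h : AlmostSubset A B) {u : NStar}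
    (hA : A ∈ u.1) : B ∈ u.1 := by
  have h1 : (A \ B)ᶜ ∈ u.1 := Ultrafilter.compl_mem_iff_notMem.2 (u.notMem_of_finite h)
  refine mem_of_superset (inter_mem hA h1) ?_
  rintro x ⟨hx, hx'⟩
  by_contra hB
  exact hx' ⟨hx, hB⟩

theorem almostSubset_of_starClopen_subset {A B : Set ℕ} (h : starClopen A ⊆ starClopen B) :
    AlmostSubset A B := by
  by_contra hinf
  obtain ⟨u, hu⟩ := NStar.exists_mem_of_infinite hinf
  have hB : B ∈ u.1 := h (show A ∈ u.1 from mem_of_superset hu sdiff_subset)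
  exact u.1.neBot.ne (empty_mem_iff_bot.1
    (by simpa using inter_mem hu hB))

theorem starIndicator_eq_of_almostEq {A B : Set ℕ} (h : AlmostEq A B) :
    starIndicator A = starIndicator B := by
  ext u
  by_cases hA : A ∈ u.1
  · rw [starIndicator_apply_of_mem hA,
      starIndicator_apply_of_mem (NStar.mem_of_almostSubset h.1 hA)]
  · rw [starIndicator_apply_of_notMem hA, starIndicator_apply_of_notMem
      fun hB => hA (NStar.mem_of_almostSubset h.2 hB)]

theorem exists_starClopen_between {K U : Set NStar} (hK : IsClosed K) (hU : IsOpen U)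
    (hKU : K ⊆ U) : ∃ D : Set ℕ, K ⊆ starClopen D ∧ starClopen D ⊆ U := by
  refine hK.isCompact.induction_on (p := fun s => ∃ D : Set ℕ, s ⊆ starClopen D ∧ starClopen D ⊆ U)
    ?_ ?_ ?_ ?_
  · exact ⟨∅, empty_subset _, fun u hu => (u.notMem_of_finite finite_empty hu).elim⟩
  · rintro s t hst ⟨D, h1, h2⟩
    exact ⟨D, hst.trans h1, h2⟩
  · rintro s t ⟨D, h1, h2⟩ ⟨E, h3, h4⟩
    refine ⟨D ∪ E, ?_, ?_⟩
    · rintro u (hu | hu)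
      · exact mem_of_superset (h1 hu) subset_union_left
      · exact mem_of_superset (h3 hu) subset_union_right
    · intro u hu
      rcases Ultrafilter.union_mem_iff.1 (show D ∪ E ∈ u.1 from hu) with h | h
      · exact h2 h
      · exact h4 h
  · intro u hu
    have hb := ultrafilterBasis_is_basis (α := ℕ)
    obtain ⟨V, hV, rfl⟩ := isOpen_induced_iff.1 hU
    obtain ⟨_, ⟨D, rfl⟩, huD, hDV⟩ := hb.exists_subset_of_mem_open (hKU hu : u.1 ∈ V) hV
    refine ⟨starClopen D, mem_nhdsWithin_of_mem_nhds
      ((isClopen_starClopen D).isOpen.mem_nhds huD), D, Subset.rfl, fun v hv => hDV hv⟩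

/-! ### Limits of bounded sequences along ultrafilters -/

/-- A bounded sequence has a limit along each ultrafilter, and the limit is a continuous function
of the ultrafilter. This is the quotient map `ℓ∞ → ℓ∞/c₀ = C(ℕ*)`. -/
theorem exists_continuousMap_tendsto (F : ℕ → ℝ) (M : ℝ) (hF : ∀ n, |F n| ≤ M) :
    ∃ φ : C(NStar, ℝ), ∀ u : NStar, Tendsto F u.1 (𝓝 (φ u)) := by
  let G : ℕ → Icc (-M) M := fun n => ⟨F n, abs_le.1 (hF n)⟩
  refine ⟨⟨fun u => ((Ultrafilter.extend G u.1 : Icc (-M) M) : ℝ), continuous_subtype_val.comp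
    ((continuous_ultrafilter_extend G).comp continuous_subtype_val)⟩, fun u => ?_⟩
  have h : Tendsto G u.1 (𝓝 (Ultrafilter.extend G u.1)) := ultrafilter_extend_eq_iff.1 rfl
  exact (continuous_subtype_val.tendsto _).comp h

theorem tendsto_indicator_starIndicator (D : Set ℕ) (u : NStar) :
    Tendsto (D.indicator (1 : ℕ → ℝ)) u.1 (𝓝 (starIndicator D u)) := by
  by_cases hD : D ∈ u.1
  · rw [starIndicator_apply_of_mem hD]
    exact tendsto_const_nhds.congr'
      (mem_of_superset hD fun n hn => (Set.indicator_of_mem hn _).symm)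
  · rw [starIndicator_apply_of_notMem hD]
    exact tendsto_const_nhds.congr' (mem_of_superset (Ultrafilter.compl_mem_iff_notMem.2 hD)
      fun n hn => (Set.indicator_of_notMem hn _).symm)

/-! ### Isometric embeddings separate countable subfamilies -/

section Separation

variable {ι : Type*}

theorem charFn_apply (X : Set ι) (hX : X.Countable) (i : ι) :
    (charFn X hX : lp (fun _ : ι => ℝ) ∞) i = X.indicator 1 i := rfl

theorem norm_le_one_of_abs_le (f : ellInftyC ι)
    (h : ∀ i, |(f : lp (fun _ : ι => ℝ) ∞) i| ≤ 1) : ‖f‖ ≤ 1 :=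
  lp.norm_le_of_forall_le zero_le_one h

/-- The function `S(1_X)` has modulus at most one after each of the perturbations `1_X - 2·1_{i}`
(`i ∈ X`) and `1_X ± 1_{i}` (`i ∉ X`). This forces it to be `1` on `[A i]` for `i ∈ X` and `0` on
`[A i]` for `i ∉ X`, so that a clopen set between `{S(1_X) = 0}` and `{S(1_X) < 1/2}` separates. -/
theorem Represents.isSeparatedFrom {S : ellInftyC ι →ₗᵢ[ℝ] C(NStar, ℝ)} {A : ι → Set ℕ}
    (hS : Represents S A) {X : Set ι} (hX : X.Countable) :
    IsSeparatedFrom (A '' Xᶜ) (A '' X) := by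
  set h := S (charFn X hX) with hh
  have key : ∀ (i : ι) (c : ℝ), (∀ j, |X.indicator (1 : ι → ℝ) j +
      c * ({i} : Set ι).indicator (1 : ι → ℝ) j| ≤ 1) →
      ∀ u : NStar, A i ∈ u.1 → |h u + c| ≤ 1 := by
    intro i c hc u hu
    have h1 : ‖charFn X hX + c • charFn {i} (Set.countable_singleton i)‖ ≤ 1 :=
      norm_le_one_of_abs_le _ hc
    rw [← S.norm_map, map_add, map_smul, hS i, ← hh] at h1
    have h2 := (ContinuousMap.norm_coe_le_norm _ u).trans h1
    simpa [starIndicator_apply_of_mem hu] using h2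
  have hone : ∀ i ∈ X, ∀ u : NStar, A i ∈ u.1 → h u = 1 := by
    intro i hi u hu
    have h1 := abs_le.1 (key i 0 (fun j => by by_cases hj : j ∈ X <;> simp [hj]) u hu)
    have h2 := abs_le.1 (key i (-2) (fun j => by
      by_cases hj : j = i
      · subst hj; simp [hi]; norm_num
      · by_cases hj' : j ∈ X <;> simp [hj, hj']) u hu)
    linarith
  have hzero : ∀ i ∉ X, ∀ u : NStar, A i ∈ u.1 → h u = 0 := by
    intro i hi u hu
    have hX' : ∀ c : ℝ, |c| ≤ 1 → ∀ j, |X.indicator (1 : ι → ℝ) j +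
        c * ({i} : Set ι).indicator (1 : ι → ℝ) j| ≤ 1 := by
      intro c hc j
      by_cases hj : j = i
      · subst hj; simpa [hi] using hc
      · by_cases hj' : j ∈ X <;> simp [hj, hj']
    have h1 := abs_le.1 (key i 1 (hX' 1 (by simp)) u hu)
    have h2 := abs_le.1 (key i (-1) (hX' (-1) (by simp)) u hu)
    linarith
  obtain ⟨D, hD1, hD2⟩ := exists_starClopen_between (K := h ⁻¹' {0}) (U := h ⁻¹' Iio (1 / 2))
    (isClosed_singleton.preimage h.continuous) (isOpen_Iio.preimage h.continuous)
    (fun u hu => by simp only [mem_preimage, mem_singleton_iff] at hu; simp [hu])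
  refine ⟨D, ?_, ?_⟩
  · rintro _ ⟨i, hi, rfl⟩
    exact almostSubset_of_starClopen_subset fun u hu => hD1 (hzero i hi u hu)
  · rintro _ ⟨i, hi, rfl⟩
    refine ⟨almostSubset_of_starClopen_subset fun u hu => ?_, by simp [AlmostSubset]⟩
    have hu' : A i ∩ D ∈ u.1 := hu
    have h1 : h u < 1 / 2 := hD2 (show D ∈ u.1 from mem_of_superset hu' inter_subset_right)
    rw [hone i hi u (mem_of_superset hu' inter_subset_left)] at h1
    norm_num at h1

end Separation

/-! ### The bounding number -/

theorem exists_unbounded_of_boundingNumber :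
    ∃ F : Set (ℕ → ℕ), #F = boundingNumber ∧
      ¬ ∃ g : ℕ → ℕ, ∀ f ∈ F, ∀ᶠ n in atTop, f n ≤ g n := by
  refine csInf_mem (s := {c | ∃ F : Set (ℕ → ℕ), #F = c ∧
    ¬ ∃ g : ℕ → ℕ, ∀ f ∈ F, ∀ᶠ n in atTop, f n ≤ g n}) ⟨_, Set.univ, rfl, ?_⟩
  rintro ⟨g, hg⟩
  obtain ⟨n, hn⟩ := (hg (fun n => g n + 1) trivial).exists
  omega

theorem exists_eventually_le_of_mk_lt {F : Set (ℕ → ℕ)} (hF : #F < boundingNumber) :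
    ∃ g : ℕ → ℕ, ∀ f ∈ F, ∀ᶠ n in atTop, f n ≤ g n := by
  by_contra h
  exact notMem_of_lt_csInf' hF ⟨F, rfl, h⟩

theorem exists_eventually_le_of_lift_mk_lt {ι : Type*} (F : ι → ℕ → ℕ)
    (h : Cardinal.lift.{0} #ι < Cardinal.lift boundingNumber) :
    ∃ g : ℕ → ℕ, ∀ i, ∀ᶠ n in atTop, F i n ≤ g n := by
  obtain ⟨g, hg⟩ := exists_eventually_le_of_mk_lt (F := range F)
    (Cardinal.lift_lt.1 (Cardinal.mk_range_le_lift.trans_lt h))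
  exact ⟨g, fun i => hg _ ⟨i, rfl⟩⟩

/-- A countable family of sequences is dominated by the sequence of its diagonal maxima. -/
theorem aleph_one_le_boundingNumber : ℵ₁ ≤ boundingNumber := by
  rw [Cardinal.aleph_one_le_iff]
  by_contra hle
  rw [not_lt] at hle
  obtain ⟨F, hF, hunb⟩ := exists_unbounded_of_boundingNumber
  rw [← hF, Cardinal.le_aleph0_iff_set_countable] at hle
  apply hunb
  rcases F.eq_empty_or_nonempty with rfl | hne
  · exact ⟨0, by simp⟩
  obtain ⟨e, rfl⟩ := hle.exists_eq_range hne
  refine ⟨fun n => ∑ i ∈ Finset.range (n + 1), e i n, ?_⟩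
  rintro _ ⟨i, rfl⟩
  filter_upwards [eventually_ge_atTop i] with n hn
  exact Finset.single_le_sum (f := fun i => e i n) (fun _ _ => Nat.zero_le _)
    (Finset.mem_range.2 (Nat.lt_succ_of_le hn))

theorem IsAlmostDisjointFamily.injective {ι : Type*} {A : ι → Set ℕ}
    (hA : IsAlmostDisjointFamily A) : Function.Injective A := fun i j hij => by
  by_contra h
  have := hA.almostDisjoint i j h
  rw [hij, inter_self] at this
  exact hA.infinite j this

/-! ### A non-separated almost disjoint family of size `𝔟` -/

/-- The `n`-th column of `ℕ × ℕ`, the latter being identified with `ℕ`. -/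
def pairColumn (n : ℕ) : Set ℕ := {m | m.unpair.1 = n}

/-- The graph, in `ℕ × ℕ` identified with `ℕ`, of the function which sends `n` to a code of
`(f ↾ n, f n)`. Coding the restrictions makes the graphs of distinct functions almost
disjoint. -/
def branchGraph (f : ℕ → ℕ) : Set ℕ :=
  range fun n => Nat.pair n (Nat.pair (Encodable.encode ((List.range n).map f)) (f n))

theorem infinite_pairColumn (n : ℕ) : (pairColumn n).Infinite :=
  (infinite_range_of_injective (f := fun k => Nat.pair n k) fun a b h => by
    simpa using h).mono (by rintro _ ⟨k, rfl⟩; simp [pairColumn])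

theorem infinite_branchGraph (f : ℕ → ℕ) : (branchGraph f).Infinite :=
  infinite_range_of_injective fun a b h => by
    simpa using congrArg (fun m => m.unpair.1) h

theorem pairColumn_inter_pairColumn {m n : ℕ} (h : m ≠ n) :
    pairColumn m ∩ pairColumn n = ∅ := by
  ext k
  simp only [pairColumn, mem_inter_iff, mem_ofPred_eq, mem_empty_iff_false, iff_false]
  rintro ⟨rfl, h'⟩
  exact h h'

theorem finite_pairColumn_inter_branchGraph (n : ℕ) (f : ℕ → ℕ) :
    (pairColumn n ∩ branchGraph f).Finite := by
  refine (finite_singleton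
    (Nat.pair n (Nat.pair (Encodable.encode ((List.range n).map f)) (f n)))).subset ?_
  rintro _ ⟨h, k, rfl⟩
  simp only [pairColumn, mem_ofPred_eq, Nat.unpair_pair] at h
  subst h
  rfl

theorem finite_branchGraph_inter_branchGraph {f g : ℕ → ℕ} (h : f ≠ g) :
    (branchGraph f ∩ branchGraph g).Finite := by
  obtain ⟨i, hi⟩ := Function.ne_iff.1 h
  refine ((finite_le_nat i).image fun n =>
    Nat.pair n (Nat.pair (Encodable.encode ((List.range n).map f)) (f n))).subset ?_
  rintro _ ⟨⟨n, rfl⟩, k, hk⟩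
  refine ⟨n, ?_, rfl⟩
  simp only [Nat.pair_eq_pair, Encodable.encode_inj] at hk
  obtain ⟨rfl, hk, -⟩ := hk
  by_contra hn
  simp only [mem_ofPred_eq, not_le] at hn
  exact hi (List.map_inj_left.1 hk i (List.mem_range.2 hn)).symm

/-- A set that almost contains the graphs of all members of `F` and meets each column in a finite
set yields a bound for `F`, namely the heights of its columns. -/
theorem not_isSeparatedFrom_branchGraph {F : Set (ℕ → ℕ)}
    (hF : ¬ ∃ g : ℕ → ℕ, ∀ f ∈ F, ∀ᶠ n in atTop, f n ≤ g n) :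
    ¬ IsSeparatedFrom (branchGraph '' F) (range pairColumn) := by
  rintro ⟨D, hD1, hD2⟩
  apply hF
  have hfin : ∀ n, (pairColumn n ∩ D).Finite := fun n => by
    simpa [AlmostSubset] using (hD2 _ ⟨n, rfl⟩).1
  choose g hg using fun n => (hfin n).bddAbove
  refine ⟨g, fun f hf => ?_⟩
  have h1 : {n | Nat.pair n (Nat.pair (Encodable.encode ((List.range n).map f)) (f n)) ∉ D}.Finite :=
    Set.Finite.of_finite_image (f := fun n =>
      Nat.pair n (Nat.pair (Encodable.encode ((List.range n).map f)) (f n)))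
      ((hD1 _ ⟨f, hf, rfl⟩).subset (by rintro _ ⟨n, hn, rfl⟩; exact ⟨⟨n, rfl⟩, hn⟩))
      (fun a _ b _ h => by simpa using congrArg (fun m => m.unpair.1) h)
  have h2 := h1.eventually_cofinite_notMem
  rw [Nat.cofinite_eq_atTop] at h2
  filter_upwards [h2] with n hn
  simp only [not_not] at hn
  exact ((Nat.right_le_pair _ _).trans (Nat.right_le_pair _ _)).trans
    (hg n ⟨by simp [pairColumn], hn⟩)

theorem mk_Below (κ : Cardinal.{0}) : #(Below κ) = Cardinal.lift.{1} κ := by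
  rw [Cardinal.mk_Iio_ordinal, Cardinal.card_ord]

theorem exists_almostDisjoint_not_separated :
    ∃ A : Below boundingNumber → Set ℕ, IsAlmostDisjointFamily A ∧
      ∃ X : Set (Below boundingNumber), X.Countable ∧ #(A '' Xᶜ) = boundingNumber ∧
        #(A '' X) = ℵ₀ ∧ ¬ IsSeparatedFrom (A '' Xᶜ) (A '' X) := by
  obtain ⟨F, hF, hunb⟩ := exists_unbounded_of_boundingNumber
  have hb : ℵ₀ ≤ boundingNumber := Cardinal.aleph0_lt_aleph_one.le.trans aleph_one_le_boundingNumber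
  obtain ⟨e⟩ : Nonempty (Below boundingNumber ≃ ℕ ⊕ F) := by
    rw [← Cardinal.lift_mk_eq', mk_Below, Cardinal.mk_sum, hF]
    simpa using (Cardinal.add_eq_right (Cardinal.aleph0_le_lift.2 hb)
      (Cardinal.aleph0_le_lift.2 hb)).symm
  let B : ℕ ⊕ F → Set ℕ := Sum.elim pairColumn fun f => branchGraph f
  have hB : IsAlmostDisjointFamily B := by
    refine ⟨inferInstance, ?_, ?_⟩
    · rintro (n | f)
      · exact infinite_pairColumn n
      · exact infinite_branchGraph f
    · rintro (m | f) (n | g) hij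
      · simp only [B, Sum.elim_inl]
        rw [pairColumn_inter_pairColumn (by simpa using hij)]
        exact finite_empty
      · exact finite_pairColumn_inter_branchGraph m g
      · rw [inter_comm]
        exact finite_pairColumn_inter_branchGraph n f
      · refine finite_branchGraph_inter_branchGraph fun h => hij ?_
        rw [Subtype.ext h]
  have hX : (B ∘ e) '' (e ⁻¹' range Sum.inl) = range pairColumn := by
    rw [image_comp, image_preimage_eq _ e.surjective, ← range_comp]
    rfl
  have hXc : (B ∘ e) '' (e ⁻¹' range Sum.inl)ᶜ = branchGraph '' F := by
    rw [← preimage_compl, image_comp, image_preimage_eq _ e.surjective, compl_range_inl,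
      ← range_comp, image_eq_range]
    rfl
  refine ⟨B ∘ e, ⟨?_, fun i => hB.infinite _,
    fun i j hij => hB.almostDisjoint _ _ (e.injective.ne hij)⟩,
    e ⁻¹' range Sum.inl, (countable_range _).preimage e.injective, ?_, ?_, ?_⟩
  · exact Infinite.of_injective (fun n : ℕ => e.symm (Sum.inl n))
      (e.symm.injective.comp Sum.inl_injective)
  · rw [hXc, ← hF]
    refine Cardinal.mk_image_eq_of_injOn _ _ fun f hf g hg hfg => ?_
    have := hB.injective (a₁ := Sum.inr ⟨f, hf⟩) (a₂ := Sum.inr ⟨g, hg⟩) hfg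
    simpa using this
  · rw [hX, Cardinal.mk_range_eq _ fun m n hmn => ?_]
    · exact Cardinal.mk_nat
    · simpa using hB.injective (a₁ := Sum.inl m) (a₂ := Sum.inl n) hmn
  · rw [hX, hXc]
    exact not_isSeparatedFrom_branchGraph hunb

/-! ### Countable ordinals -/

/-- Transfinite recursion: a family with prescribed relations between its members exists as soon
as every initial part of it can be prolonged by one member. -/
theorem exists_family_of_forall_extension {ι X : Type*} [LinearOrder ι] [WellFoundedLT ι]
    [Inhabited X] (good : ι → X → Prop) (rel : ι → ι → X → X → Prop)
    (step : ∀ (i : ι) (p : ι → X), (∀ j < i, good j (p j)) →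
      (∀ j < i, ∀ k < j, rel k j (p k) (p j)) →
      ∃ x, good i x ∧ ∀ j < i, rel j i (p j) x) :
    ∃ p : ι → X, ∀ i, good i (p i) ∧ ∀ j < i, rel j i (p j) (p i) := by
  classical
  let ext : ∀ i : ι, (∀ j, j < i → X) → X := fun i ih =>
    Classical.epsilon fun x => good i x ∧ ∀ j (hj : j < i), rel j i (ih j hj) x
  let p : ι → X := (wellFounded_lt (α := ι)).fix ext
  have hp : ∀ i, p i = ext i fun j _ => p j := fun i => WellFounded.fix_eq _ _ _
  refine ⟨p, fun i => ?_⟩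
  induction i using WellFoundedLT.induction with
  | ind i ih =>
    rw [hp i]
    exact Classical.epsilon_spec (p := fun x => good i x ∧ ∀ j, j < i → rel j i (p j) x)
      (step i p (fun j hj => (ih j hj).1) fun j hj => (ih j hj).2)

theorem countable_Iio_of_lt_omega_one {α : Ordinal.{0}} (hα : α < ω_ 1) : (Iio α).Countable := by
  rw [← Cardinal.le_aleph0_iff_set_countable, Cardinal.mk_Iio_ordinal, Cardinal.lift_le_aleph0]
  rw [← Cardinal.ord_aleph, Cardinal.lt_ord] at hα
  exact Cardinal.lt_aleph_one_iff.1 hα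

theorem succ_lt_omega_one {α : Ordinal.{0}} (hα : α < ω_ 1) : α + 1 < ω_ 1 :=
  (Cardinal.isSuccLimit_omega 1).add_one_lt hα

theorem natCast_lt_omega_one (n : ℕ) : (n : Ordinal.{0}) < ω_ 1 :=
  (Ordinal.natCast_lt_omega0 n).trans_le (Ordinal.omega0_le_omega 1)

theorem exists_forall_lt_of_countable {s : Set (Ordinal.{0})} (hs : s.Countable)
    (h : ∀ ξ ∈ s, ξ < ω_ 1) : ∃ α < ω_ 1, ∀ ξ ∈ s, ξ < α := by
  rcases s.eq_empty_or_nonempty with rfl | hne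
  · exact ⟨0, by simpa using natCast_lt_omega_one 0, by simp⟩
  obtain ⟨e, rfl⟩ := hs.exists_eq_range hne
  have hlt : ∀ n, e n + 1 < ω_ 1 := fun n => succ_lt_omega_one (h _ ⟨n, rfl⟩)
  refine ⟨⨆ n, (e n + 1), Ordinal.iSup_lt_of_lt_cof ?_ hlt, ?_⟩
  · simp
  · rintro _ ⟨n, rfl⟩
    exact (Order.lt_add_one_iff.2 le_rfl).trans_le
      (Ordinal.le_iSup (fun n => e n + 1) n)

theorem exists_monotone_cofinal {α : Ordinal.{0}} (hα : α < ω_ 1) (hlim : Order.IsSuccLimit α) :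
    ∃ a : ℕ → Ordinal.{0}, Monotone a ∧ (∀ k, a k < α) ∧ ∀ ξ < α, ∃ k, ξ < a k := by
  obtain ⟨e, he⟩ := (countable_Iio_of_lt_omega_one hα).exists_eq_range ⟨0, hlim.bot_lt⟩
  refine ⟨partialSups e, (partialSups e).monotone, fun k => ?_, fun ξ hξ => ?_⟩
  · obtain ⟨i, -, hi⟩ := exists_partialSups_eq e k
    rw [hi]
    exact he.symm.subset (mem_range_self i)
  · obtain ⟨k, hk⟩ : ξ + 1 ∈ range e := he ▸ hlim.add_one_lt hξ
    exact ⟨k, (Order.lt_add_one_iff.2 le_rfl).trans_le (hk ▸ le_partialSups e k)⟩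

theorem exists_dominating_of_lt_omega_one (hb : ℵ₁ < boundingNumber)
    (F : Ordinal.{0} → ℕ → ℕ) : ∃ g : ℕ → ℕ, ∀ ξ < ω_ 1, ∀ᶠ n in atTop, F ξ n ≤ g n := by
  obtain ⟨g, hg⟩ := exists_eventually_le_of_lift_mk_lt (fun ξ : Below ℵ₁ => F ξ)
    (by rw [mk_Below]; simpa using hb)
  exact ⟨g, fun ξ hξ => hg ⟨ξ, by simpa [Cardinal.ord_aleph] using hξ⟩⟩

/-! ### Coherent sequences of labellings -/

/-- `p : ℕ → Ordinal` labels `ℕ` by the ordinals `≤ α` in such a way that the points with label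
`ξ < α` belong to `A ξ`, and almost all points of `A ξ` have the label `min ξ α`. So `p` splits
`ℕ` into pairwise disjoint sets almost equal to the sets `A ξ`, `ξ < α`, and a remainder, labelled
`α`, that almost contains all the other sets of the family. -/
structure IsLabelling (A : Ordinal.{0} → Set ℕ) (α : Ordinal.{0}) (p : ℕ → Ordinal.{0}) :
    Prop where
  le : ∀ n, p n ≤ α
  mem : ∀ n, p n < α → n ∈ A (p n)
  finite : ∀ ξ < ω_ 1, {n | n ∈ A ξ ∧ p n ≠ min ξ α}.Finite

theorem IsLabelling.add_one {A : Ordinal.{0} → Set ℕ} {α : Ordinal.{0}} {p : ℕ → Ordinal.{0}}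
    (hp : IsLabelling A α p) (hA : ∀ ξ < ω_ 1, ξ ≠ α → (A ξ ∩ A α).Finite) :
    ∃ q, IsLabelling A (α + 1) q ∧ ∀ n, min (q n) α = p n := by
  classical
  have hlt : α < α + 1 := Order.lt_add_one_iff.2 le_rfl
  have hq : ∀ n, p n = α ∧ n ∉ A α ∨ ¬(p n = α ∧ n ∉ A α) := fun n => em _
  refine ⟨fun n => if p n = α ∧ n ∉ A α then α + 1 else p n, ⟨?_, ?_, ?_⟩, ?_⟩
  · intro n
    rcases hq n with h | h
    · simp only [if_pos h, le_refl]
    · simp only [if_neg h]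
      exact (hp.le n).trans hlt.le
  · intro n hn
    rcases hq n with h | h
    · simp only [if_pos h, lt_self_iff_false] at hn
    · simp only [if_neg h] at hn ⊢
      rcases (hp.le n).lt_or_eq with h' | h'
      · exact hp.mem n h'
      · rw [h']
        by_contra hnA
        exact h ⟨h', hnA⟩
  · intro ξ hξ
    have hfin := hp.finite ξ hξ
    rcases lt_trichotomy ξ α with h | rfl | h
    · refine hfin.subset fun n hn => ⟨hn.1, fun hpn => hn.2 ?_⟩
      rw [min_eq_left h.le] at hpn
      rw [if_neg (fun hh => h.ne (hpn.symm.trans hh.1)), hpn, min_eq_left (h.trans hlt).le]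
    · refine hfin.subset fun n hn => ⟨hn.1, fun hpn => hn.2 ?_⟩
      rw [min_self] at hpn
      rw [if_neg (fun hh => hh.2 hn.1), hpn, min_eq_left hlt.le]
    · refine (hfin.union (hA ξ hξ h.ne')).subset fun n hn => ?_
      by_cases hnA : n ∈ A α
      · exact Or.inr ⟨hn.1, hnA⟩
      · refine Or.inl ⟨hn.1, fun hpn => hn.2 ?_⟩
        rw [min_eq_right h.le] at hpn
        rw [if_pos ⟨hpn, hnA⟩, min_eq_right (Order.add_one_le_of_lt h)]
  · intro n
    rcases hq n with h | h
    · simp only [if_pos h]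
      rw [min_eq_right hlt.le, h.1]
    · simp only [if_neg h, min_eq_left (hp.le n)]

/-- At a limit `α = sup a_k`, the label of `n` is copied from the labelling with index `a_k`
whenever that label is below `a_k` and `n` is not too small relative to `k`. How small is too small
is decided by a function that dominates, for each of the remaining sets `A β` with `α ≤ β < ω₁`,
the bounds of the finite sets of points of `A β` with a label below `a_k`. -/
theorem exists_isLabelling_limit (hb : ℵ₁ < boundingNumber) {A : Ordinal.{0} → Set ℕ}
    {α : Ordinal.{0}} (hα : α < ω_ 1) (hlim : Order.IsSuccLimit α)
    {p : Ordinal.{0} → ℕ → Ordinal.{0}} (hp : ∀ β < α, IsLabelling A β (p β))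
    (hcoh : ∀ β < α, ∀ γ < β, {n | min (p β n) γ ≠ p γ n}.Finite) :
    ∃ q, IsLabelling A α q ∧ ∀ γ < α, {n | min (q n) γ ≠ p γ n}.Finite := by
  classical
  obtain ⟨a, ha_mono, ha_lt, ha_cof⟩ := exists_monotone_cofinal hα hlim
  have hcoh' : ∀ k, ∃ N, ∀ i ≤ k, ∀ n ≥ N, min (p (a k) n) (a i) = p (a i) n := by
    intro k
    have h1 : {n | ∃ i ≤ k, min (p (a k) n) (a i) ≠ p (a i) n}.Finite := by
      have : {n | ∃ i ≤ k, min (p (a k) n) (a i) ≠ p (a i) n} =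
          ⋃ i ∈ Iic k, {n | min (p (a k) n) (a i) ≠ p (a i) n} := by
        ext n; simp
      rw [this]
      refine (finite_Iic k).biUnion fun i hi => ?_
      rcases (ha_mono hi).eq_or_lt with h | h
      · rw [h]
        simp [(hp _ (ha_lt k)).le]
      · exact hcoh _ (ha_lt k) _ h
    obtain ⟨N, hN⟩ := h1.bddAbove
    refine ⟨N + 1, fun i hi n hn => ?_⟩
    by_contra hne
    have := hN ⟨i, hi, hne⟩
    omega
  choose c hc using hcoh'
  have hbound : ∀ β k, ∃ N, α ≤ β → β < ω_ 1 → ∀ n ∈ A β, p (a k) n < a k → n < N := by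
    intro β k
    by_cases hβ : α ≤ β ∧ β < ω_ 1
    · obtain ⟨N, hN⟩ := ((hp _ (ha_lt k)).finite β hβ.2).bddAbove
      refine ⟨N + 1, fun _ _ n hn hlt => Nat.lt_succ_of_le (hN ⟨hn, fun h => ?_⟩)⟩
      rw [h, min_eq_right ((ha_lt k).le.trans hβ.1)] at hlt
      exact hlt.false
    · exact ⟨0, fun h1 h2 => (hβ ⟨h1, h2⟩).elim⟩
  choose f hf using hbound
  obtain ⟨d, hd⟩ := exists_dominating_of_lt_omega_one hb f
  -- `n` receives its label from any `k` with `U k n`; past `c k` the labelling `p (a k)` is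
  -- consistent with the earlier ones, so the choice of `k` does not matter.
  let U : ℕ → ℕ → Prop := fun k n => c k ≤ n ∧ d k ≤ n ∧ p (a k) n < a k
  let q : ℕ → Ordinal.{0} := fun n => if h : ∃ k, U k n then p (a h.choose) n else α
  have hU : ∀ {k l n}, k ≤ l → U k n → U l n → p (a k) n = p (a l) n := by
    intro k l n hkl hk hl
    have h1 := hc l k hkl n hl.1
    rcases min_choice (p (a l) n) (a k) with h | h
    · rw [← h1, h]
    · exact (hk.2.2.ne (h1.symm.trans h)).elim
  have hqU : ∀ {k n}, U k n → q n = p (a k) n := by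
    intro k n hk
    have hex : ∃ k, U k n := ⟨k, hk⟩
    simp only [q, dif_pos hex]
    rcases le_total k hex.choose with h | h
    · exact (hU h hk hex.choose_spec).symm
    · exact hU h hex.choose_spec hk
  have hq_or : ∀ n, q n = α ∨ ∃ k, U k n := by
    intro n
    by_cases h : ∃ k, U k n
    · exact Or.inr h
    · exact Or.inl (dif_neg h)
  have hq_le : ∀ n, q n ≤ α := by
    intro n
    rcases hq_or n with h | ⟨k, hk⟩
    · exact h.le
    · rw [hqU hk]
      exact (hk.2.2.trans (ha_lt k)).le
  have hqa : ∀ k n, c k ≤ n → d k ≤ n → min (q n) (a k) = p (a k) n := by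
    intro k n h1 h2
    by_cases hk : U k n
    · rw [hqU hk, min_eq_left hk.2.2.le]
    have hpk : p (a k) n = a k := by
      refine ((hp _ (ha_lt k)).le n).antisymm (not_lt.1 fun h => hk ⟨h1, h2, h⟩)
    rw [hpk]
    refine min_eq_right ?_
    rcases hq_or n with h | ⟨l, hl⟩
    · rw [h]
      exact (ha_lt k).le
    · rw [hqU hl]
      rcases le_total k l with hkl | hkl
      · have h3 := hc l k hkl n hl.1
        rw [hpk] at h3
        exact min_eq_right_iff.1 h3
      · have h3 := hc k l hkl n h1
        rw [hpk, min_eq_right (ha_mono hkl)] at h3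
        exact (hl.2.2.ne h3.symm).elim
  have hfin : ∀ k, {n | min (q n) (a k) ≠ p (a k) n}.Finite := by
    intro k
    refine (finite_lt_nat (max (c k) (d k))).subset fun n hn => ?_
    by_contra hlt
    have h := max_le_iff.1 (not_lt.1 (show ¬ n < max (c k) (d k) from hlt))
    exact hn (hqa k n h.1 h.2)
  refine ⟨q, ⟨hq_le, ?_, ?_⟩, ?_⟩
  · intro n hn
    rcases hq_or n with h | ⟨k, hk⟩
    · exact (hn.ne h).elim
    · rw [hqU hk]
      exact (hp _ (ha_lt k)).mem n hk.2.2
  · intro ξ hξ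
    rcases lt_or_ge ξ α with hξα | hξα
    · obtain ⟨k, hk⟩ := ha_cof ξ hξα
      refine (((hp _ (ha_lt k)).finite ξ hξ).union (hfin k)).subset fun n hn => ?_
      by_contra hnot
      rw [mem_union, not_or] at hnot
      have h1 : min (q n) (a k) = p (a k) n := not_not.1 hnot.2
      have h2 : p (a k) n = min ξ (a k) := not_not.1 fun h => hnot.1 ⟨hn.1, h⟩
      rw [min_eq_left hk.le] at h2
      rw [h2] at h1
      have h3 : q n = ξ := by
        rcases min_choice (q n) (a k) with h | h
        · rw [← h, h1]
        · exact (hk.ne (h1.symm.trans h)).elim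
      exact hn.2 (by rw [h3, min_eq_left hξα.le])
    · obtain ⟨K, hK⟩ := eventually_atTop.1 (hd ξ hξ)
      refine ((finite_lt_nat K).biUnion (t := fun k => {n | n < f ξ k})
        fun k _ => finite_lt_nat _).subset fun n hn => ?_
      rw [min_eq_right hξα] at hn
      rcases hq_or n with h | ⟨k, hk⟩
      · exact (hn.2 h).elim
      · have h1 := hf ξ k hξα hξ n hn.1 hk.2.2
        refine mem_biUnion (x := k) ?_ h1
        by_contra hkK
        have h2 := hK k (not_lt.1 hkK)
        have h3 := hk.2.1
        omega
  · intro γ hγ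
    obtain ⟨k, hk⟩ := ha_cof γ hγ
    refine ((hfin k).union (hcoh _ (ha_lt k) _ hk)).subset fun n hn => ?_
    by_contra hnot
    rw [mem_union, not_or] at hnot
    have h1 : min (q n) (a k) = p (a k) n := not_not.1 hnot.1
    have h2 : min (p (a k) n) γ = p γ n := not_not.1 hnot.2
    refine hn ?_
    rw [← h2, ← h1, min_assoc, min_eq_right hk.le]

theorem exists_coherent_labellings (hb : ℵ₁ < boundingNumber) {A : Ordinal.{0} → Set ℕ}
    (hA : ∀ ξ < ω_ 1, ∀ η < ω_ 1, ξ ≠ η → (A ξ ∩ A η).Finite) :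
    ∃ p : Ordinal.{0} → ℕ → Ordinal.{0}, ∀ α < ω_ 1, IsLabelling A α (p α) ∧
      ∀ β < α, {n | min (p α n) β ≠ p β n}.Finite := by
  obtain ⟨p, hp⟩ := exists_family_of_forall_extension
    (fun α q => α < ω_ 1 → IsLabelling A α q)
    (fun β α r q => α < ω_ 1 → {n | min (q n) β ≠ r n}.Finite) (by
      intro α p hgood hrel
      by_cases hα : α < ω_ 1
      swap
      · exact ⟨0, fun h => (hα h).elim, fun _ _ h => (hα h).elim⟩
      rcases Ordinal.zero_or_succ_or_isSuccLimit α with rfl | ⟨β, rfl⟩ | hlim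
      · refine ⟨0, fun _ => ⟨fun n => le_rfl, fun n hn => (hn.false).elim, fun ξ _ => ?_⟩,
          fun j hj => (not_lt_zero hj).elim⟩
        simp
      · rw [Order.succ_eq_add_one] at *
        have hβ : β < β + 1 := Order.lt_add_one_iff.2 le_rfl
        have hβ1 := hβ.trans hα
        obtain ⟨q, hq, hqp⟩ := (hgood β hβ hβ1).add_one fun ξ hξ hne => hA ξ hξ β hβ1 hne
        refine ⟨q, fun _ => hq, fun γ hγ _ => ?_⟩
        rcases (Order.lt_add_one_iff.1 hγ).eq_or_lt with rfl | h
        · simp [hqp]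
        · refine (hrel β hβ γ h hβ1).subset fun n hn hn' => hn ?_
          rw [← hn', ← hqp n, min_assoc, min_eq_right h.le]
      · obtain ⟨q, hq, hqp⟩ := exists_isLabelling_limit hb hα hlim
          (fun β hβ => hgood β hβ (hβ.trans hα)) fun β hβ γ hγ => hrel β hβ γ hγ (hβ.trans hα)
        exact ⟨q, fun _ => hq, fun γ hγ _ => hqp γ hγ⟩)
  exact ⟨p, fun α hα => ⟨(hp α).1 hα, fun β hβ => (hp α).2 β hβ hα⟩⟩

/-! ### Coherent families of injections -/

/-- When `𝔟 > ω₁`, an almost disjoint family of size `ω₁` is not maximal: choose one point in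
each of the first `ω` sets, beyond the values of a function that dominates the bounds of the
intersections of these sets with the other members of the family. -/
theorem exists_injective_almostDisjoint (hb : ℵ₁ < boundingNumber) {A : Ordinal.{0} → Set ℕ}
    (hinf : ∀ ξ < ω_ 1, (A ξ).Infinite)
    (hA : ∀ ξ < ω_ 1, ∀ η < ω_ 1, ξ ≠ η → (A ξ ∩ A η).Finite) :
    ∃ z : ℕ → ℕ, Function.Injective z ∧ ∀ ξ < ω_ 1, (A ξ ∩ range z).Finite := by
  have hbound : ∀ (ξ : Ordinal.{0}) (n : ℕ), ∃ N, ξ < ω_ 1 → ξ ≠ n → ∀ m ∈ A ξ ∩ A n, m < N := by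
    intro ξ n
    by_cases h : ξ < ω_ 1 ∧ ξ ≠ n
    · obtain ⟨N, hN⟩ := (hA ξ h.1 n (natCast_lt_omega_one n) h.2).bddAbove
      exact ⟨N + 1, fun _ _ m hm => Nat.lt_succ_of_le (hN hm)⟩
    · exact ⟨0, fun h1 h2 => (h ⟨h1, h2⟩).elim⟩
  choose f hf using hbound
  obtain ⟨g, hg⟩ := exists_dominating_of_lt_omega_one hb f
  -- Avoiding the earlier sets makes `z` injective and almost disjoint from the first `ω` sets.
  have hz : ∀ n : ℕ, ∃ z ∈ A n, g n ≤ z ∧ ∀ i < n, z ∉ A i := by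
    intro n
    have hfin : ({m | m < g n} ∪ ⋃ i ∈ Iio n, A n ∩ A (i : ℕ)).Finite :=
      (finite_lt_nat _).union ((finite_Iio n).biUnion fun i hi =>
        hA _ (natCast_lt_omega_one n) _ (natCast_lt_omega_one i)
          (by simpa using (show i < n from hi).ne'))
    obtain ⟨z, hz, hz'⟩ := ((hinf n (natCast_lt_omega_one n)).sdiff hfin).nonempty
    rw [mem_union, not_or] at hz'
    refine ⟨z, hz, not_lt.1 hz'.1, fun i hi hzi => hz'.2 ?_⟩
    exact mem_biUnion (x := i) hi ⟨hz, hzi⟩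
  choose z hzA hzg hzn using hz
  refine ⟨z, fun m n hmn => ?_, fun ξ hξ => ?_⟩
  · by_contra hne
    rcases lt_or_gt_of_ne hne with h | h
    · exact hzn n m h (hmn ▸ hzA m)
    · exact hzn m n h (hmn ▸ hzA n)
  · have h1 : ∀ᶠ n : ℕ in atTop, ξ ≠ n := by
      by_cases h : ∃ i : ℕ, ξ = i
      · obtain ⟨i, rfl⟩ := h
        filter_upwards [eventually_gt_atTop i] with n hn
        exact fun h => hn.ne (by exact_mod_cast h)
      · exact Eventually.of_forall fun n hn => h ⟨n, hn⟩
    obtain ⟨K, hK⟩ := eventually_atTop.1 ((hg ξ hξ).and h1)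
    refine ((finite_lt_nat K).image z).subset ?_
    rintro _ ⟨hx, n, rfl⟩
    refine ⟨n, ?_, rfl⟩
    by_contra hn
    have h2 := hK n (not_lt.1 hn)
    have h3 := hf ξ n hξ h2.2 _ ⟨hx, hzA n⟩
    have h4 := hzg n
    omega

/-- The position of `γ` in its block: `γ = ω · (γ / ω) + blockIndex γ`. -/
noncomputable def blockIndex (γ : Ordinal.{0}) : ℕ :=
  (Ordinal.lt_omega0.1 (Ordinal.mod_lt γ Ordinal.omega0_ne_zero)).choose

theorem mul_div_add_blockIndex (γ : Ordinal.{0}) : ω * (γ / ω) + blockIndex γ = γ := by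
  rw [blockIndex, ← (Ordinal.lt_omega0.1 (Ordinal.mod_lt γ Ordinal.omega0_ne_zero)).choose_spec,
    Ordinal.div_add_mod]

theorem mul_omega0_add_natCast_div (ξ : Ordinal.{0}) (n : ℕ) : (ω * ξ + n) / ω = ξ := by
  rw [Ordinal.mul_add_div _ Ordinal.omega0_ne_zero,
    Ordinal.div_eq_zero_of_lt (Ordinal.natCast_lt_omega0 n), add_zero]

theorem blockIndex_mul_add (ξ : Ordinal.{0}) (n : ℕ) : blockIndex (ω * ξ + n) = n := by
  have h := mul_div_add_blockIndex (ω * ξ + n)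
  rw [mul_omega0_add_natCast_div] at h
  exact_mod_cast (add_right_inj _).1 h

theorem eq_of_div_eq_of_blockIndex_eq {γ δ : Ordinal.{0}} (h : γ / ω = δ / ω)
    (h' : blockIndex γ = blockIndex δ) : γ = δ := by
  rw [← mul_div_add_blockIndex γ, h, h', mul_div_add_blockIndex]

theorem mem_ordBlock_iff {γ ξ : Ordinal.{0}} : γ ∈ ordBlock ξ ↔ γ / ω = ξ := by
  constructor
  · rintro ⟨h1, h2⟩
    refine le_antisymm ?_ ((Ordinal.mul_le_iff_le_div Ordinal.omega0_ne_zero).1 h1)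
    rw [← Order.lt_add_one_iff, ← Ordinal.lt_mul_iff_div_lt Ordinal.omega0_ne_zero, mul_add_one]
    exact h2
  · rintro rfl
    have h := mul_div_add_blockIndex γ
    constructor
    · exact Ordinal.mul_div_le _ _
    · nth_rewrite 1 [← h]
      exact (add_lt_add_iff_left _).2 (Ordinal.natCast_lt_omega0 _)

/-- The coherent labellings `p α` of a family disjoint from `range z` yield a coherent family of
injections. In the block of `ξ`, `s α` follows the increasing enumeration of `A ξ`, except for the
finitely many members of `A ξ` whose label is not `ξ`. The values at these exceptional places
are taken in `range z`; they are indexed through the coherent injections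
`ξ ↦ min {m | p α m = ξ}` of `α` into `ω`. -/
theorem exists_isCoherentFamily_of_labellings {A : Ordinal.{0} → Set ℕ}
    (hinf : ∀ ξ < ω_ 1, (A ξ).Infinite) {z : ℕ → ℕ} (hz : Function.Injective z)
    (hAz : ∀ ξ < ω_ 1, Disjoint (A ξ) (range z)) {p : Ordinal.{0} → ℕ → Ordinal.{0}}
    (hp : ∀ α < ω_ 1, IsLabelling A α (p α) ∧ ∀ β < α, {n | min (p α n) β ≠ p β n}.Finite) :
    ∃ s, IsCoherentFamily s ∧ ∀ ξ < ω_ 1, AlmostEq (A ξ) (s (ξ + 1) '' ordBlock ξ) := by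
  classical
  let a : Ordinal.{0} → ℕ → ℕ := fun ξ => Nat.nth (· ∈ A ξ)
  have ha_mem : ∀ ξ < ω_ 1, ∀ n, a ξ n ∈ A ξ := fun ξ hξ n =>
    Nat.nth_mem_of_infinite (p := (· ∈ A ξ)) (hinf ξ hξ) n
  have ha_inj : ∀ ξ < ω_ 1, Function.Injective (a ξ) := fun ξ hξ =>
    Nat.nth_injective (p := (· ∈ A ξ)) (hinf ξ hξ)
  have ha_surj : ∀ ξ < ω_ 1, ∀ m ∈ A ξ, ∃ n, a ξ n = m := fun ξ hξ m hm => by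
    have h := Nat.range_nth_of_infinite (p := (· ∈ A ξ)) (hinf ξ hξ)
    exact h.symm.subset hm
  -- For `ξ < α` the set below is non-empty, so the infimum is a point with label `ξ`.
  let t : Ordinal.{0} → Ordinal.{0} → ℕ := fun α ξ => sInf {m | p α m = ξ}
  have ht : ∀ α < ω_ 1, ∀ ξ < α, p α (t α ξ) = ξ := by
    intro α hα ξ hξ
    have hfin := (hp α hα).1.finite ξ (hξ.trans hα)
    obtain ⟨m, hm, hm'⟩ := ((hinf ξ (hξ.trans hα)).sdiff hfin).nonempty
    refine Nat.sInf_mem (s := {m | p α m = ξ}) ⟨m, ?_⟩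
    by_contra hne
    exact hm' ⟨hm, by rwa [min_eq_left hξ.le]⟩
  have ht_coh : ∀ α < ω_ 1, ∀ β < α, {ξ | ξ < β ∧ t α ξ ≠ t β ξ}.Finite := by
    intro α hα β hβ
    have hfin := (hp α hα).2 β hβ
    refine ((hfin.image (p α)).union (hfin.image (p β))).subset ?_
    rintro ξ ⟨hξ, hne⟩
    by_contra hnot
    rw [mem_union, not_or] at hnot
    refine hne (congrArg sInf (Set.ext fun m => ?_))
    change p α m = ξ ↔ p β m = ξ
    constructor
    · intro hm
      by_contra hm'
      refine hnot.1 ⟨m, fun h => hm' ?_, hm⟩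
      rw [← h, hm, min_eq_left hξ.le]
    · intro hm
      by_contra hm'
      refine hnot.2 ⟨m, fun h => hm' ?_, hm⟩
      rw [hm] at h
      rcases min_choice (p α m) β with h' | h'
      · rw [← h', h]
      · exact (hξ.ne (h.symm.trans h')).elim
  let s : Ordinal.{0} → Ordinal.{0} → ℕ := fun α γ =>
    if p α (a (γ / ω) (blockIndex γ)) = γ / ω then a (γ / ω) (blockIndex γ)
    else z (Nat.pair (t α (γ / ω)) (blockIndex γ))
  have hs_pos : ∀ {α γ}, p α (a (γ / ω) (blockIndex γ)) = γ / ω →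
      s α γ = a (γ / ω) (blockIndex γ) := fun h => if_pos h
  have hs_neg : ∀ {α γ}, p α (a (γ / ω) (blockIndex γ)) ≠ γ / ω →
      s α γ = z (Nat.pair (t α (γ / ω)) (blockIndex γ)) := fun h => if_neg h
  have hbad : ∀ α < ω_ 1, ∀ ξ < α, {γ | γ / ω = ξ ∧ p α (a ξ (blockIndex γ)) ≠ ξ}.Finite := by
    intro α hα ξ hξ
    have hξ1 := hξ.trans hα
    refine Set.Finite.of_finite_image (f := fun γ => a ξ (blockIndex γ))
      (((hp α hα).1.finite ξ hξ1).subset ?_) ?_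
    · rintro _ ⟨γ, ⟨-, hγ⟩, rfl⟩
      exact ⟨ha_mem ξ hξ1 _, by rwa [min_eq_left hξ.le]⟩
    · intro γ hγ δ hδ h
      exact eq_of_div_eq_of_blockIndex_eq (hγ.1.trans hδ.1.symm) (ha_inj ξ hξ1 h)
  refine ⟨s, ⟨fun α hα γ hγ δ hδ h => ?_, fun α hα β hβ => ?_⟩, fun ξ hξ => ⟨?_, ?_⟩⟩
  · have hγ' : γ / ω < α := (Ordinal.lt_mul_iff_div_lt Ordinal.omega0_ne_zero).1 hγ
    have hδ' : δ / ω < α := (Ordinal.lt_mul_iff_div_lt Ordinal.omega0_ne_zero).1 hδ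
    have hmemγ := ha_mem _ (hγ'.trans hα) (blockIndex γ)
    have hmemδ := ha_mem _ (hδ'.trans hα) (blockIndex δ)
    by_cases h1 : p α (a (γ / ω) (blockIndex γ)) = γ / ω <;>
      by_cases h2 : p α (a (δ / ω) (blockIndex δ)) = δ / ω
    · rw [hs_pos h1, hs_pos h2] at h
      have h3 : γ / ω = δ / ω := by rw [← h1, h, h2]
      rw [← h3] at h
      exact eq_of_div_eq_of_blockIndex_eq h3 (ha_inj _ (hγ'.trans hα) h)
    · rw [hs_pos h1, hs_neg h2] at h
      exact ((hAz _ (hγ'.trans hα)).le_bot ⟨hmemγ, _, h.symm⟩).elim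
    · rw [hs_neg h1, hs_pos h2] at h
      exact ((hAz _ (hδ'.trans hα)).le_bot ⟨hmemδ, _, h⟩).elim
    · rw [hs_neg h1, hs_neg h2] at h
      obtain ⟨h3, h4⟩ := Nat.pair_eq_pair.1 (hz h)
      refine eq_of_div_eq_of_blockIndex_eq ?_ h4
      rw [← ht α hα _ hγ', h3, ht α hα _ hδ']
  · have hβ1 := hβ.trans hα
    have hfin := (hp α hα).2 β hβ
    -- A disagreement of `s α` and `s β` at `γ` either sits over one of the finitely many points
    -- where the labellings disagree, or `γ` is exceptional for both and its block is one of the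
    -- finitely many at which `t α` and `t β` differ.
    have h1 : {γ | γ < ω * β ∧
        min (p α (a (γ / ω) (blockIndex γ))) β ≠ p β (a (γ / ω) (blockIndex γ)) ∧
        (p α (a (γ / ω) (blockIndex γ)) = γ / ω ∨
          p β (a (γ / ω) (blockIndex γ)) = γ / ω)}.Finite := by
      refine Set.Finite.of_finite_image (f := fun γ => (γ / ω, a (γ / ω) (blockIndex γ)))
        ((((hfin.image (p α)).union (hfin.image (p β))).prod hfin).subset ?_) ?_
      · rintro _ ⟨γ, ⟨-, h, h'⟩, rfl⟩
        exact ⟨h'.imp (fun h' => ⟨_, h, h'⟩) (fun h' => ⟨_, h, h'⟩), h⟩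
      · rintro γ ⟨hγ, -⟩ δ - h
        obtain ⟨h3, h4⟩ := Prod.mk.inj h
        have hγ' : γ / ω < β := (Ordinal.lt_mul_iff_div_lt Ordinal.omega0_ne_zero).1 hγ
        rw [← h3] at h4
        exact eq_of_div_eq_of_blockIndex_eq h3 (ha_inj _ (hγ'.trans hβ1) h4)
    have h2 : {γ | γ / ω ∈ {ξ | ξ < β ∧ t α ξ ≠ t β ξ} ∧
        p β (a (γ / ω) (blockIndex γ)) ≠ γ / ω}.Finite := by
      refine ((ht_coh α hα β hβ).biUnion fun ξ hξ => hbad β hβ1 ξ hξ.1).subset ?_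
      rintro γ ⟨hγ, h⟩
      exact mem_biUnion hγ ⟨rfl, h⟩
    refine (h1.union h2).subset ?_
    rintro γ ⟨hγ, hne⟩
    have hγ' : γ / ω < β := (Ordinal.lt_mul_iff_div_lt Ordinal.omega0_ne_zero).1 hγ
    by_contra hnot
    rw [mem_union, not_or] at hnot
    by_cases h3 : p α (a (γ / ω) (blockIndex γ)) = γ / ω <;>
      by_cases h4 : p β (a (γ / ω) (blockIndex γ)) = γ / ω
    · exact hne (by rw [hs_pos h3, hs_pos h4])
    · refine hnot.1 ⟨hγ, fun h => h4 ?_, Or.inl h3⟩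
      rw [← h, h3, min_eq_left hγ'.le]
    · refine hnot.1 ⟨hγ, fun h => h3 ?_, Or.inr h4⟩
      rw [h4] at h
      rcases min_choice (p α (a (γ / ω) (blockIndex γ))) β with h' | h'
      · rw [← h', h]
      · exact (hγ'.ne (h.symm.trans h')).elim
    · rw [hs_neg h3, hs_neg h4] at hne
      exact hnot.2 ⟨⟨hγ', fun h => hne (by rw [h])⟩, h4⟩
  · have hlt : ξ < ξ + 1 := Order.lt_add_one_iff.2 le_rfl
    refine ((hp _ (succ_lt_omega_one hξ)).1.finite ξ hξ).subset ?_
    rintro m ⟨hm, hm'⟩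
    refine ⟨hm, fun h => hm' ?_⟩
    rw [min_eq_left hlt.le] at h
    obtain ⟨n, rfl⟩ := ha_surj ξ hξ m hm
    have hdiv := mul_omega0_add_natCast_div ξ n
    have hidx := blockIndex_mul_add ξ n
    refine ⟨ω * ξ + n, mem_ordBlock_iff.2 hdiv, ?_⟩
    rw [hs_pos (by rw [hdiv, hidx, h]), hdiv, hidx]
  · have hlt : ξ < ξ + 1 := Order.lt_add_one_iff.2 le_rfl
    refine ((hbad _ (succ_lt_omega_one hξ) ξ hlt).image (s (ξ + 1))).subset ?_
    rintro _ ⟨⟨γ, hγ, rfl⟩, hnot⟩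
    have hγ' := mem_ordBlock_iff.1 hγ
    refine ⟨γ, ⟨hγ', fun h => hnot ?_⟩, rfl⟩
    rw [hs_pos (by rw [hγ', h]), hγ']
    exact ha_mem ξ hξ _

/-- The sets are first made disjoint from an infinite set `range z` almost disjoint from all of
them, which leaves room for the exceptional values of the injections. -/
theorem exists_isCoherentFamily (hb : ℵ₁ < boundingNumber) {A : Ordinal.{0} → Set ℕ}
    (hinf : ∀ ξ < ω_ 1, (A ξ).Infinite)
    (hA : ∀ ξ < ω_ 1, ∀ η < ω_ 1, ξ ≠ η → (A ξ ∩ A η).Finite) :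
    ∃ s, IsCoherentFamily s ∧ ∀ ξ < ω_ 1, AlmostEq (A ξ) (s (ξ + 1) '' ordBlock ξ) := by
  obtain ⟨z, hz, hAz⟩ := exists_injective_almostDisjoint hb hinf hA
  have hfin : ∀ ξ < ω_ 1, (A ξ \ (A ξ \ range z)).Finite := fun ξ hξ => by
    rw [sdiff_sdiff_right_self]
    exact hAz ξ hξ
  obtain ⟨p, hp⟩ := exists_coherent_labellings hb (A := fun ξ => A ξ \ range z)
    fun ξ hξ η hη hne => (hA ξ hξ η hη hne).subset
      (inter_subset_inter sdiff_subset sdiff_subset)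
  obtain ⟨s, hs, hsA⟩ := exists_isCoherentFamily_of_labellings (A := fun ξ => A ξ \ range z)
    (fun ξ hξ h => hinf ξ hξ (((hfin ξ hξ).union h).subset fun m hm => by
      by_cases hm' : m ∈ A ξ \ range z
      · exact Or.inr hm'
      · exact Or.inl ⟨hm, hm'⟩)) hz (fun ξ _ => disjoint_sdiff_left) hp
  refine ⟨s, hs, fun ξ hξ => ⟨((hfin ξ hξ).union (hsA ξ hξ).1).subset fun m hm => ?_,
    (hsA ξ hξ).2.subset fun m hm => ⟨hm.1, fun h => hm.2 h.1⟩⟩⟩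
  by_cases hm' : m ∈ A ξ \ range z
  · exact Or.inr ⟨hm', hm.2⟩
  · exact Or.inl ⟨hm.1, hm'⟩

/-! ### The isometric embedding given by a coherent family -/

/-- The sequence with the constant value `h ξ` on the image under `s α` of the block of `ξ`, for
`ξ < α`, and the value zero outside the range of `s α`. -/
noncomputable def blockSequence (s : Ordinal.{0} → Ordinal.{0} → ℕ) (α : Ordinal.{0})
    (h : Ordinal.{0} → ℝ) (m : ℕ) : ℝ :=
  open scoped Classical in
  if hm : ∃ γ, γ < ω * α ∧ s α γ = m then h (hm.choose / ω) else 0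

section BlockSequence

variable {s : Ordinal.{0} → Ordinal.{0} → ℕ} {α : Ordinal.{0}}

theorem blockSequence_apply (hs : InjOn (s α) (Iio (ω * α))) (h : Ordinal.{0} → ℝ)
    {γ : Ordinal.{0}} (hγ : γ < ω * α) : blockSequence s α h (s α γ) = h (γ / ω) := by
  have hm : ∃ δ, δ < ω * α ∧ s α δ = s α γ := ⟨γ, hγ, rfl⟩
  rw [blockSequence, dif_pos hm, hs hm.choose_spec.1 hγ hm.choose_spec.2]

theorem blockSequence_of_not_exists (h : Ordinal.{0} → ℝ) {m : ℕ}
    (hm : ¬ ∃ γ, γ < ω * α ∧ s α γ = m) : blockSequence s α h m = 0 :=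
  dif_neg hm

theorem blockSequence_add (h k : Ordinal.{0} → ℝ) (m : ℕ) :
    blockSequence s α (h + k) m = blockSequence s α h m + blockSequence s α k m := by
  unfold blockSequence
  split_ifs <;> simp

theorem blockSequence_smul (c : ℝ) (h : Ordinal.{0} → ℝ) (m : ℕ) :
    blockSequence s α (c • h) m = c * blockSequence s α h m := by
  unfold blockSequence
  split_ifs <;> simp

theorem abs_blockSequence_le {h : Ordinal.{0} → ℝ} {M : ℝ} (hM : 0 ≤ M) (hh : ∀ ξ, |h ξ| ≤ M)
    (m : ℕ) : |blockSequence s α h m| ≤ M := by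
  unfold blockSequence
  split_ifs
  · exact hh _
  · simpa using hM

/-- By coherence, the block sequences given by `s α` and `s β` agree almost everywhere as long as
both ordinals bound the support. -/
theorem IsCoherentFamily.finite_blockSequence_ne (hs : IsCoherentFamily s) {β : Ordinal.{0}}
    (hα : α < ω_ 1) (hβ : β < α) {h : Ordinal.{0} → ℝ} (hh : ∀ ξ, h ξ ≠ 0 → ξ < β) :
    {m | blockSequence s β h m ≠ blockSequence s α h m}.Finite := by
  have hβ1 := hβ.trans hα
  have hle : ω * β ≤ ω * α := mul_le_mul_right hβ.le ω
  have hfin := hs.coherent α hα β hβ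
  refine ((hfin.image (s α)).union (hfin.image (s β))).subset fun m hm => ?_
  by_contra hnot
  rw [mem_union, not_or] at hnot
  refine hm ?_
  have hcase : ∀ γ < ω * β, s α γ = m ∨ s β γ = m → s α γ = m ∧ s β γ = m := by
    rintro γ hγ (h1 | h1)
    · have : s α γ = s β γ := by
        by_contra hne
        exact hnot.1 ⟨γ, ⟨hγ, hne⟩, h1⟩
      exact ⟨h1, this ▸ h1⟩
    · have : s α γ = s β γ := by
        by_contra hne
        exact hnot.2 ⟨γ, ⟨hγ, hne⟩, h1⟩
      exact ⟨this ▸ h1, h1⟩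
  by_cases h1 : ∃ γ < ω * β, s α γ = m ∨ s β γ = m
  · obtain ⟨γ, hγ, h2⟩ := h1
    obtain ⟨h3, h4⟩ := hcase γ hγ h2
    have h5 := blockSequence_apply (hs.injOn α hα) h (hγ.trans_le hle)
    have h6 := blockSequence_apply (hs.injOn β hβ1) h hγ
    rw [h3] at h5
    rw [h4] at h6
    rw [h5, h6]
  · rw [blockSequence_of_not_exists h fun ⟨γ, hγ, h2⟩ => h1 ⟨γ, hγ, Or.inr h2⟩]
    by_cases h2 : ∃ γ, γ < ω * α ∧ s α γ = m
    · obtain ⟨γ, hγ, rfl⟩ := h2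
      rw [blockSequence_apply (hs.injOn α hα) h hγ]
      by_contra hne
      exact h1 ⟨γ, (Ordinal.lt_mul_iff_div_lt Ordinal.omega0_ne_zero).2 (hh _ (Ne.symm hne)),
        Or.inl rfl⟩
    · rw [blockSequence_of_not_exists h h2]

end BlockSequence

/-- The extension of `f` by zero to all ordinals. -/
noncomputable def zeroExtend {κ : Cardinal.{0}} (f : ellInftyC (Below κ)) : Ordinal.{0} → ℝ :=
  Function.extend Subtype.val (f : lp (fun _ : Below κ => ℝ) ∞) 0

section ZeroExtend

variable {κ : Cardinal.{0}}

theorem zeroExtend_coe (f : ellInftyC (Below κ)) (ξ : Below κ) :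
    zeroExtend f ξ = (f : lp (fun _ : Below κ => ℝ) ∞) ξ :=
  Subtype.val_injective.extend_apply _ _ _

theorem zeroExtend_of_notMem (f : ellInftyC (Below κ)) {ξ : Ordinal.{0}} (hξ : ξ ∉ Iio κ.ord) :
    zeroExtend f ξ = 0 :=
  Function.extend_apply' _ _ _ fun ⟨η, h⟩ => hξ (h ▸ η.2)

theorem zeroExtend_add (f g : ellInftyC (Below κ)) :
    zeroExtend (f + g) = zeroExtend f + zeroExtend g := by
  funext ξ
  by_cases hξ : ξ ∈ Iio κ.ord
  · have h := fun f : ellInftyC (Below κ) => zeroExtend_coe f ⟨ξ, hξ⟩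
    simp only [] at h
    rw [Pi.add_apply, h, h, h]
    rfl
  · simp [zeroExtend_of_notMem _ hξ]

theorem zeroExtend_smul (c : ℝ) (f : ellInftyC (Below κ)) :
    zeroExtend (c • f) = c • zeroExtend f := by
  funext ξ
  by_cases hξ : ξ ∈ Iio κ.ord
  · have h := fun f : ellInftyC (Below κ) => zeroExtend_coe f ⟨ξ, hξ⟩
    simp only [] at h
    rw [Pi.smul_apply, h, h]
    rfl
  · simp [zeroExtend_of_notMem _ hξ]

theorem abs_zeroExtend_le (f : ellInftyC (Below κ)) (ξ : Ordinal.{0}) :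
    |zeroExtend f ξ| ≤ ‖f‖ := by
  by_cases hξ : ξ ∈ Iio κ.ord
  · rw [zeroExtend_coe f ⟨ξ, hξ⟩]
    exact lp.norm_apply_le_norm ENNReal.top_ne_zero
      (f : lp (fun _ : Below κ => ℝ) ∞) ⟨ξ, hξ⟩
  · simp [zeroExtend_of_notMem f hξ]

theorem exists_support_zeroExtend_lt (f : ellInftyC (Below ℵ₁)) :
    ∃ α < ω_ 1, ∀ ξ, zeroExtend f ξ ≠ 0 → ξ < α := by
  have hf : (Function.support (f : lp (fun _ : Below ℵ₁ => ℝ) ∞)).Countable := f.2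
  obtain ⟨α, hα, h⟩ := exists_forall_lt_of_countable (hf.image Subtype.val) (by
    rintro _ ⟨ξ, -, rfl⟩
    simpa [Cardinal.ord_aleph] using ξ.2)
  refine ⟨α, hα, fun ξ hξ => h ξ ?_⟩
  by_cases hmem : ξ ∈ Iio (ℵ₁).ord
  · refine ⟨⟨ξ, hmem⟩, ?_, rfl⟩
    rw [zeroExtend_coe f ⟨ξ, hmem⟩] at hξ
    exact hξ
  · exact (hξ (zeroExtend_of_notMem f hmem)).elim

end ZeroExtend

/-- The embedding sends `f` to the class modulo `c₀` of the block sequence of `f`, computed with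
any `s α` such that `α` bounds the support of `f`. It preserves the norm since each value of `f` is
taken by the sequence on an infinite set. -/
theorem IsCoherentFamily.exists_linearIsometry {s : Ordinal.{0} → Ordinal.{0} → ℕ}
    (hs : IsCoherentFamily s) :
    ∃ S : ellInftyC (Below ℵ₁) →ₗᵢ[ℝ] C(NStar, ℝ), ∀ f, ∀ α < ω_ 1,
      (∀ ξ, zeroExtend f ξ ≠ 0 → ξ < α) → ∀ u : NStar,
        Tendsto (blockSequence s α (zeroExtend f)) u.1 (𝓝 (S f u)) := by
  have hexists : ∀ f : ellInftyC (Below ℵ₁), ∃ φ : C(NStar, ℝ), ∀ α < ω_ 1,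
      (∀ ξ, zeroExtend f ξ ≠ 0 → ξ < α) → ∀ u : NStar,
        Tendsto (blockSequence s α (zeroExtend f)) u.1 (𝓝 (φ u)) := by
    intro f
    obtain ⟨β, hβ, hfβ⟩ := exists_support_zeroExtend_lt f
    obtain ⟨φ, hφ⟩ := exists_continuousMap_tendsto (blockSequence s β (zeroExtend f)) ‖f‖
      (abs_blockSequence_le (norm_nonneg f) (abs_zeroExtend_le f))
    refine ⟨φ, fun α hα hfα u => (hφ u).congr' ?_⟩
    have hfin : {m | blockSequence s β (zeroExtend f) m ≠
        blockSequence s α (zeroExtend f) m}.Finite := by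
      rcases lt_trichotomy α β with h | rfl | h
      · simpa only [ne_comm] using hs.finite_blockSequence_ne hβ h hfα
      · simp
      · exact hs.finite_blockSequence_ne hα h hfβ
    filter_upwards [Ultrafilter.compl_mem_iff_notMem.2 (u.notMem_of_finite hfin)] with m hm
    exact not_not.1 hm
  choose φ hφ using hexists
  have hadd : ∀ f g, φ (f + g) = φ f + φ g := by
    intro f g
    ext u
    obtain ⟨β, hβ, hfβ⟩ := exists_support_zeroExtend_lt f
    obtain ⟨γ, hγ, hgγ⟩ := exists_support_zeroExtend_lt g
    have hα := max_lt hβ hγ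
    have hf : ∀ ξ, zeroExtend f ξ ≠ 0 → ξ < max β γ := fun ξ h => lt_max_of_lt_left (hfβ ξ h)
    have hg : ∀ ξ, zeroExtend g ξ ≠ 0 → ξ < max β γ := fun ξ h => lt_max_of_lt_right (hgγ ξ h)
    have hfg : ∀ ξ, zeroExtend (f + g) ξ ≠ 0 → ξ < max β γ := by
      intro ξ h
      by_contra hlt
      rw [zeroExtend_add, Pi.add_apply, not_not.1 (mt (hf ξ) hlt),
        not_not.1 (mt (hg ξ) hlt), add_zero] at h
      exact h rfl
    refine tendsto_nhds_unique (hφ (f + g) _ hα hfg u) ?_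
    refine ((hφ f _ hα hf u).add (hφ g _ hα hg u)).congr fun m => ?_
    rw [zeroExtend_add, blockSequence_add]
  have hsmul : ∀ (c : ℝ) f, φ (c • f) = c • φ f := by
    intro c f
    ext u
    obtain ⟨α, hα, hf⟩ := exists_support_zeroExtend_lt f
    have hcf : ∀ ξ, zeroExtend (c • f) ξ ≠ 0 → ξ < α := by
      intro ξ h
      refine hf ξ fun h0 => h ?_
      rw [zeroExtend_smul, Pi.smul_apply, h0, smul_zero]
    refine tendsto_nhds_unique (hφ (c • f) _ hα hcf u) ?_
    refine ((hφ f _ hα hf u).const_mul c).congr fun m => ?_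
    rw [zeroExtend_smul, blockSequence_smul]
  have hnorm : ∀ f, ‖φ f‖ = ‖f‖ := by
    intro f
    obtain ⟨α, hα, hf⟩ := exists_support_zeroExtend_lt f
    refine le_antisymm ((ContinuousMap.norm_le _ (norm_nonneg f)).2 fun u => ?_)
      (lp.norm_le_of_forall_le (norm_nonneg _) fun ξ => ?_)
    · exact le_of_tendsto (hφ f α hα hf u).norm (Eventually.of_forall
        (abs_blockSequence_le (norm_nonneg f) (abs_zeroExtend_le f)))
    · change ‖(f : lp (fun _ : Below ℵ₁ => ℝ) ∞) ξ‖ ≤ ‖φ f‖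
      rw [← zeroExtend_coe]
      by_cases h0 : zeroExtend f ξ = 0
      · rw [h0, norm_zero]
        exact norm_nonneg _
      have hlt : ∀ n : ℕ, ω * (ξ : Ordinal.{0}) + n < ω * α := fun n => by
        rw [Ordinal.lt_mul_iff_div_lt Ordinal.omega0_ne_zero, mul_omega0_add_natCast_div]
        exact hf ξ h0
      have hinf : (range fun n : ℕ => s α (ω * (ξ : Ordinal.{0}) + n)).Infinite :=
        infinite_range_of_injective fun m n h => by
          simpa using hs.injOn α hα (hlt m) (hlt n) h
      obtain ⟨u, hu⟩ := NStar.exists_mem_of_infinite hinf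
      have hval : φ f u = zeroExtend f ξ := by
        refine tendsto_nhds_unique (hφ f α hα hf u) (tendsto_const_nhds.congr' ?_)
        filter_upwards [hu]
        rintro _ ⟨n, rfl⟩
        rw [blockSequence_apply (hs.injOn α hα) _ (hlt n), mul_omega0_add_natCast_div]
      rw [← hval]
      exact ContinuousMap.norm_coe_le_norm _ u
  exact ⟨⟨⟨⟨φ, hadd⟩, hsmul⟩, hnorm⟩, hφ⟩

theorem blockSequence_zeroExtend_charFn {s : Ordinal.{0} → Ordinal.{0} → ℕ} {α : Ordinal.{0}}
    (hs : InjOn (s α) (Iio (ω * α))) {κ : Cardinal.{0}} {X : Set (Below κ)} (hX : X.Countable)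
    (hXα : ∀ ξ ∈ X, (ξ : Ordinal.{0}) < α) :
    blockSequence s α (zeroExtend (charFn X hX)) =
      (s α '' ⋃ ξ ∈ X, ordBlock ξ).indicator 1 := by
  funext m
  by_cases hm : m ∈ s α '' ⋃ ξ ∈ X, ordBlock ξ
  · rw [indicator_of_mem hm]
    obtain ⟨γ, hγ, rfl⟩ := hm
    obtain ⟨ξ, hξ, hγξ⟩ := mem_iUnion₂.1 hγ
    rw [mem_ordBlock_iff] at hγξ
    rw [blockSequence_apply hs _ ((Ordinal.lt_mul_iff_div_lt Ordinal.omega0_ne_zero).2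
      (hγξ ▸ hXα ξ hξ)), hγξ, zeroExtend_coe, charFn_apply, indicator_of_mem hξ]
    rfl
  · rw [indicator_of_notMem hm]
    by_cases h : ∃ γ, γ < ω * α ∧ s α γ = m
    · obtain ⟨γ, hγ, rfl⟩ := h
      rw [blockSequence_apply hs _ hγ]
      by_cases hmem : γ / ω ∈ Iio κ.ord
      · rw [zeroExtend_coe _ ⟨γ / ω, hmem⟩, charFn_apply]
        refine indicator_of_notMem (fun hγX => hm ⟨γ, ?_, rfl⟩) _
        exact mem_iUnion₂.2 ⟨_, hγX, mem_ordBlock_iff.2 rfl⟩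
      · exact zeroExtend_of_notMem _ hmem
    · exact blockSequence_of_not_exists _ h

/-! ### The characterization of `𝔟 = ω₁` -/

theorem exists_isCoherentFamily_represents (hb : ℵ₁ < boundingNumber) (A : Below ℵ₁ → Set ℕ)
    (hA : IsAlmostDisjointFamily A) :
    ∃ s : Ordinal.{0} → Ordinal.{0} → ℕ, IsCoherentFamily s ∧
      (∀ ξ : Below ℵ₁, AlmostEq (A ξ) (s ((ξ : Ordinal.{0}) + 1) '' ordBlock ξ)) ∧
      ∃ S : ellInftyC (Below ℵ₁) →ₗᵢ[ℝ] C(NStar, ℝ), Represents S A ∧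
        ∀ (X : Set (Below ℵ₁)) (hX : X.Countable), ∀ α < ω_ 1,
          (∀ ξ ∈ X, (ξ : Ordinal.{0}) < α) →
            S (charFn X hX) = starIndicator (s α '' ⋃ ξ ∈ X, ordBlock ξ) := by
  have hord : (ℵ₁).ord = ω_ 1 := Cardinal.ord_aleph 1
  let B : Ordinal.{0} → Set ℕ := Function.extend Subtype.val A fun _ => ∅
  have hB : ∀ ξ : Below ℵ₁, B ξ = A ξ := fun ξ => Subtype.val_injective.extend_apply _ _ _
  obtain ⟨s, hs, hsB⟩ := exists_isCoherentFamily hb (A := B)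
    (fun ξ hξ => hB ⟨ξ, hord ▸ hξ⟩ ▸ hA.infinite _)
    (fun ξ hξ η hη hne => hB ⟨ξ, hord ▸ hξ⟩ ▸ hB ⟨η, hord ▸ hη⟩ ▸
      hA.almostDisjoint _ _ fun h => hne (congrArg Subtype.val h))
  have hsA : ∀ ξ : Below ℵ₁, AlmostEq (A ξ) (s ((ξ : Ordinal.{0}) + 1) '' ordBlock ξ) :=
    fun ξ => hB ξ ▸ hsB ξ (hord ▸ ξ.2)
  obtain ⟨S, hS⟩ := hs.exists_linearIsometry
  have hSX : ∀ (X : Set (Below ℵ₁)) (hX : X.Countable), ∀ α < ω_ 1,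
      (∀ ξ ∈ X, (ξ : Ordinal.{0}) < α) →
        S (charFn X hX) = starIndicator (s α '' ⋃ ξ ∈ X, ordBlock ξ) := by
    intro X hX α hα hXα
    ext u
    have hsupp : ∀ ξ, zeroExtend (charFn X hX) ξ ≠ 0 → ξ < α := by
      intro ξ hξ
      by_cases hmem : ξ ∈ Iio (ℵ₁).ord
      · rw [zeroExtend_coe _ ⟨ξ, hmem⟩, charFn_apply] at hξ
        exact hXα _ (mem_of_indicator_ne_zero hξ)
      · exact (hξ (zeroExtend_of_notMem _ hmem)).elim
    have h := hS (charFn X hX) α hα hsupp u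
    rw [blockSequence_zeroExtend_charFn (hs.injOn α hα) hX hXα] at h
    exact tendsto_nhds_unique h (tendsto_indicator_starIndicator _ u)
  refine ⟨s, hs, hsA, S, fun ξ => ?_, hSX⟩
  have hξ : (ξ : Ordinal.{0}) < ω_ 1 := hord ▸ ξ.2
  rw [hSX {ξ} _ (ξ + 1) (succ_lt_omega_one hξ)
    (fun η hη => by rw [mem_singleton_iff.1 hη]; exact Order.lt_add_one_iff.2 le_rfl),
    biUnion_singleton]
  exact (starIndicator_eq_of_almostEq (hsA ξ)).symm

theorem exists_not_separated_not_represents :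
    ∃ A : Below boundingNumber → Set ℕ, IsAlmostDisjointFamily A ∧
      (∃ ℬ 𝒞 : Set (Set ℕ), Set.range A = ℬ ∪ 𝒞 ∧ Disjoint ℬ 𝒞 ∧
        #ℬ = boundingNumber ∧ #𝒞 = ℵ₀ ∧ ¬ IsSeparatedFrom ℬ 𝒞) ∧
      ¬ ∃ S : ellInftyC (Below boundingNumber) →ₗᵢ[ℝ] C(NStar, ℝ), Represents S A := by
  obtain ⟨A, hA, X, hX, hℬ, h𝒞, hsep⟩ := exists_almostDisjoint_not_separated
  refine ⟨A, hA, ⟨A '' Xᶜ, A '' X, ?_, ?_, hℬ, h𝒞, hsep⟩, ?_⟩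
  · rw [← image_union, compl_union_self, image_univ]
  · exact (disjoint_image_iff hA.injective).2 disjoint_compl_left
  · rintro ⟨S, hS⟩
    exact hsep (hS.isSeparatedFrom hX)

theorem boundingNumber_eq_aleph_one_iff :
    boundingNumber = ℵ₁ ↔
      ∃ A : Below ℵ₁ → Set ℕ, IsAlmostDisjointFamily A ∧
        ¬ ∃ S : ellInftyC (Below ℵ₁) →ₗᵢ[ℝ] C(NStar, ℝ), Represents S A := by
  constructor
  · intro h
    have key : ∃ A : Below boundingNumber → Set ℕ, IsAlmostDisjointFamily A ∧
        ¬ ∃ S : ellInftyC (Below boundingNumber) →ₗᵢ[ℝ] C(NStar, ℝ), Represents S A := by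
      obtain ⟨A, hA, -, hS⟩ := exists_not_separated_not_represents
      exact ⟨A, hA, hS⟩
    rwa [h] at key
  · rintro ⟨A, hA, hS⟩
    refine (aleph_one_le_boundingNumber.eq_or_lt.resolve_right fun hb => hS ?_).symm
    obtain ⟨s, -, -, S, hSA, -⟩ := exists_isCoherentFamily_represents hb A hA
    exact ⟨S, hSA⟩

theorem theorem1p4 :
    -- the equivalence
    (boundingNumber = ℵ₁ ↔
      ∃ A : Below ℵ₁ → Set ℕ, IsAlmostDisjointFamily A ∧
        ¬ ∃ S : ellInftyC (Below ℵ₁) →ₗᵢ[ℝ] C(NStar, ℝ), Represents S A) ∧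
    -- a family of size `𝔟`, which is a non-separated pair, in ZFC
    (∃ A : Below boundingNumber → Set ℕ, IsAlmostDisjointFamily A ∧
      (∃ ℬ 𝒞 : Set (Set ℕ), Set.range A = ℬ ∪ 𝒞 ∧ Disjoint ℬ 𝒞 ∧
        #ℬ = boundingNumber ∧ #𝒞 = ℵ₀ ∧ ¬ IsSeparatedFrom ℬ 𝒞) ∧
      ¬ ∃ S : ellInftyC (Below boundingNumber) →ₗᵢ[ℝ] C(NStar, ℝ), Represents S A) ∧
    -- embeddings built through coherent families when `𝔟 > ω₁`
    (ℵ₁ < boundingNumber →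
      ∀ A : Below ℵ₁ → Set ℕ, IsAlmostDisjointFamily A →
        ∃ s : Ordinal.{0} → Ordinal.{0} → ℕ, IsCoherentFamily s ∧
          (∀ ξ : Below ℵ₁, AlmostEq (A ξ) (s ((ξ : Ordinal.{0}) + 1) '' ordBlock ξ)) ∧
          ∃ S : ellInftyC (Below ℵ₁) →ₗᵢ[ℝ] C(NStar, ℝ), Represents S A ∧
            ∀ (X : Set (Below ℵ₁)) (hX : X.Countable), ∀ α < ω_ 1,
              (∀ ξ ∈ X, (ξ : Ordinal.{0}) < α) →
                S (charFn X hX) = starIndicator (s α '' ⋃ ξ ∈ X, ordBlock ξ)) := by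
  exact ⟨boundingNumber_eq_aleph_one_iff, exists_not_separated_not_represents,
    exists_isCoherentFamily_represents⟩
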